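/- Consider a network of $U\ge 1$ identical energy harvesting sensors, each with a battery of capacity $e_{\max}\ge 1$, in a fixed scenario $s$ with energy arrival probability $\beta(s)\in(0,1)$. **Packets.** In every slot each sensor holds a packet with utility $V>0$, $\mathbb E[V]<\infty$, an observation $Y$ (a continuous random variable with support $(0,\infty)$) and a channel SNR $\gamma$. The transmission can be decoded when no other sensor transmits and $\gamma>\gamma_{\rm th}(Y)$, where $\gamma_{\rm th}$ is a given threshold function. The triples $(V,Y,\gamma)$ are i.i.d. over slots and sensors. Let $\bar V(y)=\mathbb E[\mathbf 1\{\gamma>\gamma_{\rm th}(Y)\}V\mid Y=y]$. Assume that $\bar V$ is continuous on $[0,\infty)$ and strictly increasing on $(0,\infty)$, with $\bar V(0)=0$ and $\bar V(y)\to\infty$ as $y\to\infty$. For $x\in[0,1]$ let $y_{\rm th}(x)\in[0,\infty]$ be the threshold with $\mathbb P(Y\ge y_{\rm th}(x))=x$, and let $$g(x)=\mathbb E\big[\mathbf 1\{\gamma>\gamma_{\rm th}(Y)\}\,\mathbf 1\{Y\ge y_{\rm th}(x)\}\,V\big].$$ **Policies.** An admissible policy is a function $\eta:\{0,\dots,e_{\max}\}\to[0,1]$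 with $\eta(0)=0$, $\eta(e)\in(0,1)$ for $0<e<e_{\max}$ and $\eta(e_{\max})\in(0,1]$. A sensor with energy level $e$ transmits with probability $\eta(e)$. Its energy level evolves as the Markov chain $E_{k+1}=\min\{E_k-Q_k+B_k,\,e_{\max}\}$, where, given $E_k$, the variables $Q_k\sim\mathrm{Bernoulli}(\eta(E_k))$ and $B_k\sim\mathrm{Bernoulli}(\beta(s))$ are independent. Let $\pi_\eta$ be its (unique) stationary distribution and put $$G(\eta)=\sum_{e=1}^{e_{\max}}\pi_\eta(e)\,g(\eta(e)),\qquad P(\eta)=\sum_{e=1}^{e_{\max}}\pi_\eta(e)\,\eta(e),\qquad \Lambda(\eta)=(U-1)\frac{G(\eta)}{1-P(\eta)} .$$ **Theorem.** There is exactly one admissible policy $\eta^*$ that satisfies the symmetric Nash equilibrium condition $$\eta^*\in\arg\max_{\eta\ \text{admissible}}\big[G(\eta)-\Lambda(\eta^*)P(\eta)\big].$$ Moreover, $\eta^*$ is the strict maximizer, i.e. $G(\eta^*)-\Lambda(\eta^*)P(\eta^*)>G(\eta)-\Lambda(\eta^*)P(\eta)$ for every admissible $\eta\ne\eta^*$,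 and $P(\eta^*)\le\min\{\beta(s),1/U\}$. -/

import Mathlib

open MeasureTheory Set Filter Topology

noncomputable section

namespace EHNetwork

/-! ### The data packets -/

/-- The random quantities attached to one data packet, common (in law) to all sensors and slots:
utility `V`, utility observation `Y`, channel SNR `γ`, and the SNR decoding threshold `γth`,
a function of the observation.  The three variables may be arbitrarily correlated.  The utility is
positive with finite mean; `Y` is a continuous random variable with support `(0, ∞)`. -/
structure PacketModel {Ω : Type*} [MeasurableSpace Ω] (μ : Measure Ω) where
  V : Ω → ℝ
  Y : Ω → ℝ
  γ : Ω → ℝ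
  γth : ℝ → ℝ
  measurable_V : Measurable V
  measurable_Y : Measurable Y
  measurable_γ : Measurable γ
  measurable_γth : Measurable γth
  V_pos : ∀ᵐ ω ∂μ, 0 < V ω
  V_integrable : Integrable V μ
  Y_pos : ∀ᵐ ω ∂μ, 0 < Y ω
  Y_absolutelyContinuous : μ.map Y ≪ volume
  Y_support : ∀ a b : ℝ, 0 ≤ a → a < b → 0 < μ {ω | Y ω ∈ Ioo a b}

namespace PacketModel

variable {Ω : Type*} [MeasurableSpace Ω] {μ : Measure Ω} (M : PacketModel μ)

/-- The event that the channel is not in outage. -/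
def decodable : Set Ω := {ω | M.γth (M.Y ω) < M.γ ω}

/-- `Vbar` is (a version of) `y ↦ 𝔼[χ(γ > γth(Y)) V | Y = y]`. -/
def IsExpectedUtility (Vbar : ℝ → ℝ) : Prop :=
  μ[M.decodable.indicator M.V | MeasurableSpace.comap M.Y inferInstance]
    =ᵐ[μ] fun ω => Vbar (M.Y ω)

/-- The standing assumption on the expected utility: it is strictly increasing and continuous,
starts from `0` at `0` and tends to infinity. -/
structure RegularUtility (Vbar : ℝ → ℝ) : Prop where
  strictMono : StrictMonoOn Vbar (Ioi 0)
  continuous : ContinuousOn Vbar (Ici 0)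
  zero : Vbar 0 = 0
  tendsto : Tendsto Vbar atTop atTop

/-- The censoring threshold on `Y` that induces the transmission probability `x`, i.e. the solution
`y` of `P(Y ≥ y) = x`; it is `⊤` (never transmit) for `x = 0`. -/
def censoringThreshold (x : ℝ) : EReal :=
  sSup {y : EReal | x ≤ μ.real {ω | y ≤ (M.Y ω : EReal)}}

/-- The expected utility `g(x) = 𝔼[χ(γ > γth(Y)) Q V]`, with `Q = χ(Y ≥ yth(x))`, delivered in one
slot without collisions by the threshold rule with transmission probability `x`. -/
def g (x : ℝ) : ℝ :=
  ∫ ω in {ω | M.censoringThreshold x ≤ (M.Y ω : EReal)} ∩ M.decodable, M.V ω ∂μ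

end PacketModel

/-! ### The battery of one sensor in a fixed scenario -/

/-- Admissible policies in a fixed scenario: `η e` is the probability of transmitting at energy
level `e ∈ {0, …, emax}`. -/
def Admissible {emax : ℕ} (η : Fin (emax + 1) → ℝ) : Prop :=
  η 0 = 0 ∧ η (Fin.last emax) ∈ Ioc 0 1 ∧ ∀ e, e ≠ 0 → e ≠ Fin.last emax → η e ∈ Ioo 0 1

/-- Bernoulli weights on `{0, 1}`. -/
def bern (p : ℝ) (i : Fin 2) : ℝ := if i = 1 then p else 1 - p

/-- Transition probabilities of the energy level `E ↦ min (E - Q + B) emax`, with independent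
`Q ∼ Bernoulli (η E)` and `B ∼ Bernoulli b`.  (With `η 0 = 0`, the event `E = 0`, `Q = 1`, where
the subtraction truncates, has probability zero.) -/
def transition {emax : ℕ} (b : ℝ) (η : Fin (emax + 1) → ℝ) :
    Matrix (Fin (emax + 1)) (Fin (emax + 1)) ℝ := fun e f =>
  ∑ q : Fin 2, ∑ a : Fin 2, bern (η e) q * bern b a *
    if min ((e : ℕ) - (q : ℕ) + (a : ℕ)) emax = (f : ℕ) then 1 else 0

/-- `p` is a steady-state (stationary) distribution of the energy level. -/
def IsSteadyState {emax : ℕ} (b : ℝ) (η p : Fin (emax + 1) → ℝ) : Prop :=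
  p ∈ stdSimplex ℝ (Fin (emax + 1)) ∧ Matrix.vecMul p (transition b η) = p

/-- Net probability flow across the cut between levels `i` and `i + 1`. -/
def cutFlow {emax : ℕ} (b : ℝ) (η p : Fin (emax + 1) → ℝ) (i : Fin emax) : ℝ :=
  b * (1 - η i.castSucc) * p i.castSucc - (1 - b) * η i.succ * p i.succ

theorem vecMul_transition {emax : ℕ} {b : ℝ} {η p : Fin (emax + 1) → ℝ} (h0 : η 0 = 0)
    (f : Fin (emax + 1)) :
    Matrix.vecMul p (transition b η) f = p f
      - (∑ i : Fin emax, if i.castSucc = f then cutFlow b η p i else 0)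
      + ∑ i : Fin emax, if i.succ = f then cutFlow b η p i else 0 := by
  have hT : ∀ e, p e * transition b η e f =
      (if e = f then p e * ((1 - η e) * (1 - b) + η e * b) else 0)
      + (if min ((e : ℕ) + 1) emax = f then p e * ((1 - η e) * b) else 0)
      + (if (e : ℕ) - 1 = f then p e * (η e * (1 - b)) else 0) := by
    intro e
    have he := e.is_lt
    have h1 : min (e : ℕ) emax = e := by omega
    have h2 : min ((e : ℕ) - 1) emax = (e : ℕ) - 1 := by omega
    simp only [transition, Fin.sum_univ_two, Fin.isValue, Fin.val_zero, Fin.val_one,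
      tsub_zero, add_zero, h1, h2, Fin.ext_iff]
    rcases Nat.eq_zero_or_pos (e : ℕ) with h | h
    · have : e = 0 := Fin.ext h
      subst this
      have e0 : ((0 : Fin (emax + 1)) : ℕ) = 0 := rfl
      simp only [h0, e0, zero_add, Nat.zero_sub]
      have b0 : ∀ x : ℝ, bern x 0 = 1 - x := fun x => if_neg zero_ne_one
      have b1 : ∀ x : ℝ, bern x 1 = x := fun x => if_pos rfl
      simp only [b0, b1]
      split_ifs <;> ring
    · have h3 : min ((e : ℕ) - 1 + 1) emax = e := by omega
      simp only [h3, bern]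
      split_ifs <;> simp_all <;> ring
  have hc : p f = (∑ e, if e = f then p e else 0) := by simp
  simp only [Matrix.vecMul, dotProduct, hT, Finset.sum_add_distrib]
  have hA : (∑ e : Fin (emax + 1), if min ((e : ℕ) + 1) emax = f then p e * ((1 - η e) * b) else 0)
      = (∑ i : Fin emax, if i.succ = f then p i.castSucc * ((1 - η i.castSucc) * b) else 0)
        + if Fin.last emax = f then p f * ((1 - η f) * b) else 0 := by
    rw [Fin.sum_univ_castSucc]
    congr 1
    · refine Finset.sum_congr rfl fun i _ => ?_
      have : min ((i : ℕ) + 1) emax = i + 1 := by omega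
      simp only [Fin.val_castSucc, this, Fin.ext_iff, Fin.val_succ]
    · by_cases h : Fin.last emax = f
      · subst h; simp
      · have : ¬ (emax = (f : ℕ)) := fun h' => h (Fin.ext h')
        simp [h, this]
  have hB : (∑ e : Fin (emax + 1), if (e : ℕ) - 1 = f then p e * (η e * (1 - b)) else 0)
      = ∑ i : Fin emax, if i.castSucc = f then p i.succ * (η i.succ * (1 - b)) else 0 := by
    rw [Fin.sum_univ_succ, h0]
    simp [Fin.ext_iff]
  have hC : p f * ((1 - η f) * b)
      = (∑ i : Fin emax, if i.castSucc = f then p i.castSucc * ((1 - η i.castSucc) * b) else 0)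
        + if Fin.last emax = f then p f * ((1 - η f) * b) else 0 := by
    have : p f * ((1 - η f) * b) = ∑ e, if e = f then p e * ((1 - η e) * b) else 0 := by simp
    rw [this, Fin.sum_univ_castSucc]
    congr 1
    by_cases h : Fin.last emax = f
    · subst h; simp
    · simp [h]
  have hD : p f * (η f * (1 - b))
      = ∑ i : Fin emax, if i.succ = f then p i.succ * (η i.succ * (1 - b)) else 0 := by
    have : p f * (η f * (1 - b)) = ∑ e, if e = f then p e * (η e * (1 - b)) else 0 := by simp
    rw [this, Fin.sum_univ_succ, h0]
    simp
  have hE : ∀ q : Fin emax → Prop, ∀ _ : DecidablePred q,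
      (∑ i : Fin emax, if q i then cutFlow b η p i else 0)
      = (∑ i : Fin emax, if q i then p i.castSucc * ((1 - η i.castSucc) * b) else 0)
        - ∑ i : Fin emax, if q i then p i.succ * (η i.succ * (1 - b)) else 0 := by
    intro q _
    rw [← Finset.sum_sub_distrib]
    refine Finset.sum_congr rfl fun i _ => ?_
    unfold cutFlow
    split_ifs <;> ring
  rw [hA, hB, hE, hE]
  simp only [Finset.sum_ite_eq', Finset.mem_univ, if_true]
  linear_combination -hC - hD

theorem isSteadyState_iff {emax : ℕ} {b : ℝ} {η p : Fin (emax + 1) → ℝ} (h0 : η 0 = 0) :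
    IsSteadyState b η p ↔ p ∈ stdSimplex ℝ (Fin (emax + 1)) ∧ ∀ i, cutFlow b η p i = 0 := by
  refine and_congr_right fun _ => ⟨fun h => ?_, fun h => ?_⟩
  · cases emax with
    | zero => exact fun i => i.elim0
    | succ n =>
      intro i
      induction i using Fin.induction with
      | zero =>
        have h1 := congrFun h 0
        rw [vecMul_transition h0] at h1
        have h2 : ∀ j : Fin (n + 1), j.castSucc = 0 ↔ j = 0 := by
          intro j; simp only [Fin.ext_iff, Fin.val_castSucc, Fin.val_zero]
        simp only [h2, Fin.succ_ne_zero, if_false, Finset.sum_const_zero,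
          Finset.sum_ite_eq', Finset.mem_univ, if_true] at h1
        linarith
      | succ i ih =>
        have h1 := congrFun h i.succ.castSucc
        rw [vecMul_transition h0] at h1
        have h2 : ∀ j : Fin (n + 1), j.succ = i.succ.castSucc ↔ j = i.castSucc := by
          intro j; simp only [Fin.ext_iff, Fin.val_castSucc, Fin.val_succ, Nat.add_right_cancel_iff]
        have h3 : ∀ j : Fin (n + 1), j.castSucc = i.succ.castSucc ↔ j = i.succ := by
          intro j; simp only [Fin.ext_iff, Fin.val_castSucc]
        simp only [h2, h3, ih, Finset.sum_ite_eq', Finset.mem_univ, if_true] at h1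
        linarith
  · funext f
    rw [vecMul_transition h0]
    simp [h]

/-- Under an admissible policy the steady-state distribution exists and is unique. -/
theorem existsUnique_steadyState {emax : ℕ} {b : ℝ} (hb : b ∈ Ioo (0 : ℝ) 1)
    {η : Fin (emax + 1) → ℝ} (hη : Admissible η) : ∃! p, IsSteadyState b η p := by
  obtain ⟨hb0, hb1⟩ := hb
  obtain ⟨h0, hl, hm⟩ := hη
  have hpos : ∀ i : Fin emax, 0 < η i.succ := by
    intro i
    by_cases h : i.succ = Fin.last emax
    · rw [h]; exact hl.1
    · exact (hm _ (Fin.succ_ne_zero i) h).1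
  have hlt : ∀ i : Fin emax, η i.castSucc < 1 := by
    intro i
    by_cases h : i.castSucc = 0
    · rw [h, h0]; exact one_pos
    · exact (hm _ h (Fin.castSucc_lt_last i).ne).2
  let w : Fin (emax + 1) → ℝ := Fin.induction 1
    fun i x => b * (1 - η i.castSucc) * x / ((1 - b) * η i.succ)
  have hw0 : w 0 = 1 := rfl
  have hws : ∀ i : Fin emax,
      w i.succ = b * (1 - η i.castSucc) * w i.castSucc / ((1 - b) * η i.succ) := fun i => rfl
  have hden : ∀ i : Fin emax, 0 < (1 - b) * η i.succ :=
    fun i => mul_pos (by linarith) (hpos i)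
  have hw : ∀ e, 0 < w e := by
    intro e
    induction e using Fin.induction with
    | zero => rw [hw0]; exact one_pos
    | succ i ih =>
      rw [hws]
      exact div_pos (mul_pos (mul_pos hb0 (by linarith [hlt i])) ih) (hden i)
  have hW : 0 < ∑ e, w e := Finset.sum_pos (fun e _ => hw e) Finset.univ_nonempty
  refine ⟨fun e => w e / ∑ e, w e, (isSteadyState_iff h0).2 ⟨⟨fun e => ?_, ?_⟩, fun i => ?_⟩, ?_⟩
  · exact (div_pos (hw e) hW).le
  · rw [← Finset.sum_div, div_self hW.ne']
  · have h := hws i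
    rw [eq_div_iff (hden i).ne'] at h
    simp only [cutFlow]
    field_simp
    linear_combination -h
  · intro p hp
    obtain ⟨hp, hc⟩ := (isSteadyState_iff h0).1 hp
    have hpw : ∀ e, p e = p 0 * w e := by
      intro e
      induction e using Fin.induction with
      | zero => rw [hw0, mul_one]
      | succ i ih =>
        have h := hws i
        rw [eq_div_iff (hden i).ne'] at h
        have h' := hc i
        simp only [cutFlow, ih] at h'
        refine mul_right_cancel₀ (hden i).ne' ?_
        linear_combination -h' - p 0 * h
    have hs : p 0 * ∑ e, w e = 1 := by
      rw [Finset.mul_sum, ← hp.2]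
      exact Finset.sum_congr rfl fun e _ => (hpw e).symm
    funext e
    rw [hpw e, eq_div_iff hW.ne']
    linear_combination w e * hs

open Classical in
/-- The steady-state distribution of the energy level; the `else` branch is never taken for
admissible policies and `0 < b < 1`, by `existsUnique_steadyState`. -/
def steadyState {emax : ℕ} (b : ℝ) (η : Fin (emax + 1) → ℝ) : Fin (emax + 1) → ℝ :=
  if h : ∃! p, IsSteadyState b η p then h.choose else 0

/-- Under an admissible policy, `steadyState b η` is a steady-state distribution. -/
theorem isSteadyState_steadyState {emax : ℕ} {b : ℝ} (hb : b ∈ Ioo (0 : ℝ) 1)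
    {η : Fin (emax + 1) → ℝ} (hη : Admissible η) : IsSteadyState b η (steadyState b η) := by
  have h := existsUnique_steadyState hb hη
  rw [steadyState, dif_pos h]
  exact h.choose_spec.1

/-- Average transmission probability `P(η) = ∑_{e = 1}^{emax} π_η(e) η(e)`. -/
def avgTransmission {emax : ℕ} (b : ℝ) (η : Fin (emax + 1) → ℝ) : ℝ :=
  ∑ i : Fin emax, steadyState b η i.succ * η i.succ

section Game

variable {Ω : Type*} [MeasurableSpace Ω] {μ : Measure Ω} (M : PacketModel μ)

/-- Average utility without collisions, `G(η) = ∑_{e = 1}^{emax} π_η(e) g(η(e))`. -/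
def avgUtility {emax : ℕ} (b : ℝ) (η : Fin (emax + 1) → ℝ) : ℝ :=
  ∑ i : Fin emax, steadyState b η i.succ * M.g (η i.succ)

/-- `Λ(η) = (U - 1) G(η) / (1 - P(η))`, for a network of `U` sensors. -/
def multiplier {emax : ℕ} (U : ℕ) (b : ℝ) (η : Fin (emax + 1) → ℝ) : ℝ :=
  ((U : ℝ) - 1) * avgUtility M b η / (1 - avgTransmission b η)

/-- `G(η) - Λ(η₀) P(η)`: up to a positive factor and an additive constant not depending on `η`, the
network utility when one sensor uses `η` and its `U - 1` competitors all use `η₀`. -/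
def payoff {emax : ℕ} (U : ℕ) (b : ℝ) (η₀ η : Fin (emax + 1) → ℝ) : ℝ :=
  avgUtility M b η - multiplier M U b η₀ * avgTransmission b η

/-- `η₀` is an admissible policy satisfying the symmetric Nash equilibrium condition
`η₀ ∈ argmax_η [G(η) - Λ(η₀) P(η)]` over the admissible policies. -/
def IsSNE {emax : ℕ} (U : ℕ) (b : ℝ) (η₀ : Fin (emax + 1) → ℝ) : Prop :=
  Admissible η₀ ∧ ∀ η, Admissible η → payoff M U b η₀ η ≤ payoff M U b η₀ η₀

end Game

end EHNetwork

end

noncomputable section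

namespace EHNetwork

/-! The game becomes concave once a policy `η` is replaced by its occupation measure `(p, z)` with
`p = π_η` and `z = p η`. Stationarity is then a set of linear balance equations, `P` is linear, and
`G` is a sum of perspectives `a * g (z / a)` of a strictly concave `g`. Concavity of `g` holds
because `Vbar y` is a strict supergradient at the probability with threshold `y`. The growth of
`Vbar` at infinity makes the slope of `g` unbounded near `0`, and `Vbar 0 = 0` makes it vanish at
`1` (`IsExpectedUtility.isUtilityCurve`).

Existence: `G (1 - P) ^ (U - 1)` attains its maximum on the compact polytope of occupation measures.
Its first-order condition says that the maximizer also maximizes `G - Λ P` for its own `Λ`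
(`exists_isPricedMax`). The end slopes of `g` keep such a maximizer off the excluded faces:
transmissions cannot vanish at an occupied positive level (`fst_eq_zero_of_snd_eq_zero`) and cannot
be certain below capacity (`snd_lt_fst`). It is therefore the measure of an admissible policy.
Strict concavity makes it the strict maximizer (`IsPricedMax.lt_of_ne`).

Uniqueness: `Λ` increases with both `G` and `P`, so of two equilibria the one that transmits more
faces the larger price, which contradicts strict preference (`not_payoff_lt_of_payoff_le`). The
bound `1 / U` follows from comparison with permanent silence, which gives `G ≥ Λ P`. -/

/-- The properties of the map from transmission probability to expected utility that the analysis
of the battery-limited transmission game relies on. -/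
structure IsUtilityCurve (g : ℝ → ℝ) : Prop where
  zero : g 0 = 0
  strictConcaveOn : StrictConcaveOn ℝ (Icc 0 1) g
  continuousOn : ContinuousOn g (Icc 0 1)
  lt_one : ∀ x ∈ Ico (0 : ℝ) 1, g x < g 1
  slope_zero : ∀ C : ℝ, ∃ x ∈ Ioo (0 : ℝ) 1, C * x < g x
  slope_one : ∀ δ > 0, ∃ x ∈ Ioo (0 : ℝ) 1, g 1 - g x ≤ δ * (1 - x)

/-! ### Threshold rules and the concave utility curve they generate. -/

namespace PacketModel

/-- Continuity at `0` gives `Vbar 0 ≤ Vbar (y / 2)`, and strictness comes from the step between `y /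
2` and `y`. -/
theorem RegularUtility.strictMonoOn_Ici {Vbar : ℝ → ℝ} (h : RegularUtility Vbar) :
    StrictMonoOn Vbar (Ici 0) := by
  have hpos : ∀ y, 0 < y → Vbar 0 < Vbar y := by
    intro y hy
    have h1 : Vbar 0 ≤ Vbar (y / 2) := by
      have hc : Tendsto Vbar (𝓝[>] 0) (𝓝 (Vbar 0)) :=
        (h.continuous 0 self_mem_Ici).mono_left (nhdsWithin_mono _ Ioi_subset_Ici_self)
      refine le_of_tendsto hc ?_
      filter_upwards [Ioo_mem_nhdsGT (half_pos hy)] with z hz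
      exact (h.strictMono hz.1 (half_pos hy) hz.2).le
    exact h1.trans_lt (h.strictMono (half_pos hy) hy (half_lt_self hy))
  intro a ha b hb hab
  rcases (mem_Ici.1 ha).eq_or_lt with rfl | ha'
  · exact hpos b hab
  · exact h.strictMono ha' (ha'.trans hab) hab

variable {Ω : Type*} [MeasurableSpace Ω] {μ : Measure Ω}

theorem nullSingletonClass_map (M : PacketModel μ) : NullSingletonClass (μ.map M.Y) :=
  ⟨fun x => M.Y_absolutelyContinuous (measure_singleton x)⟩

theorem ae_ne (M : PacketModel μ) (y : ℝ) : ∀ᵐ ω ∂μ, M.Y ω ≠ y := by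
  have := M.nullSingletonClass_map
  have h : μ.map M.Y {y} = 0 := measure_singleton y
  rw [Measure.map_apply M.measurable_Y (measurableSet_singleton y)] at h
  exact measure_eq_zero_iff_ae_notMem.1 h

/-- The probability that the observation is at least `y`. -/
def tail (M : PacketModel μ) (y : ℝ) : ℝ := μ.real {ω | y ≤ M.Y ω}

theorem measurableSet_le_Y (M : PacketModel μ) (y : ℝ) : MeasurableSet {ω | y ≤ M.Y ω} :=
  measurableSet_le measurable_const M.measurable_Y

theorem censoringThreshold_zero (M : PacketModel μ) : M.censoringThreshold 0 = ⊤ :=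
  top_le_iff.1 (le_sSup measureReal_nonneg)

/-- The event of transmission under the threshold rule with transmission probability `x`. -/
def transmitSet (M : PacketModel μ) (x : ℝ) : Set Ω :=
  {ω | M.censoringThreshold x ≤ (M.Y ω : EReal)}

theorem transmitSet_zero (M : PacketModel μ) : M.transmitSet 0 = ∅ := by
  ext ω
  simp [transmitSet, censoringThreshold_zero]

theorem measurableSet_comap_transmitSet (M : PacketModel μ) (x : ℝ) :
    MeasurableSet[MeasurableSpace.comap M.Y inferInstance] (M.transmitSet x) :=
  ⟨{y : ℝ | M.censoringThreshold x ≤ (y : EReal)},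
    measurableSet_le measurable_const measurable_coe_real_ereal, rfl⟩

theorem measurableSet_transmitSet (M : PacketModel μ) (x : ℝ) : MeasurableSet (M.transmitSet x) :=
  M.measurable_Y.comap_le _ (M.measurableSet_comap_transmitSet x)

theorem transmitSet_mono (M : PacketModel μ) : Monotone M.transmitSet := by
  intro x x' h ω hω
  have h1 : M.censoringThreshold x' ≤ M.censoringThreshold x :=
    sSup_le_sSup fun z hz => h.trans hz
  exact h1.trans hω

theorem measurableSet_decodable (M : PacketModel μ) : MeasurableSet M.decodable :=
  measurableSet_lt (M.measurable_γth.comp M.measurable_Y) M.measurable_γ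

theorem IsExpectedUtility.integrable {M : PacketModel μ} {Vbar : ℝ → ℝ}
    (h : M.IsExpectedUtility Vbar) : Integrable (fun ω => Vbar (M.Y ω)) μ :=
  integrable_condExp.congr h

variable [IsProbabilityMeasure μ]

theorem tail_zero (M : PacketModel μ) : M.tail 0 = 1 := by
  have h : μ {ω | 0 ≤ M.Y ω} = 1 := by
    rw [← prob_compl_eq_zero_iff (M.measurableSet_le_Y 0)]
    filter_upwards [M.Y_pos] with ω hω using hω.le
  simp [tail, measureReal_def, h]

theorem tail_lt (M : PacketModel μ) {y z : ℝ} (hy : 0 ≤ y) (hyz : y < z) :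
    M.tail z < M.tail y := by
  have h := M.Y_support y z hy hyz
  have h1 : μ.real ({ω | M.Y ω ∈ Ioo y z} ∪ {ω | z ≤ M.Y ω}) ≤ M.tail y := by
    refine measureReal_mono ?_
    rintro ω (hω | hω)
    · exact hω.1.le
    · exact hyz.le.trans hω
  rw [measureReal_union ?_ (M.measurableSet_le_Y z)] at h1
  · have h2 : 0 < μ.real {ω | M.Y ω ∈ Ioo y z} := ENNReal.toReal_pos h.ne' (measure_ne_top _ _)
    unfold tail at *
    linarith
  · rw [Set.disjoint_left]
    intro ω hω hω'
    exact absurd hω.2 (not_lt.2 hω')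

theorem tail_eq_one_sub_cdf (M : PacketModel μ) (y : ℝ) :
    M.tail y = 1 - ProbabilityTheory.cdf (μ.map M.Y) y := by
  have := M.nullSingletonClass_map
  have := Measure.isProbabilityMeasure_map (μ := μ) M.measurable_Y.aemeasurable
  rw [ProbabilityTheory.cdf_eq_real, ← probReal_compl_eq_one_sub measurableSet_Iic, compl_Iic,
    ← measureReal_congr Ioi_ae_eq_Ici.symm, map_measureReal_apply M.measurable_Y measurableSet_Ici]
  rfl

theorem tendsto_tail (M : PacketModel μ) : Tendsto M.tail atTop (𝓝 0) := by
  have := Measure.isProbabilityMeasure_map (μ := μ) M.measurable_Y.aemeasurable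
  have h := (ProbabilityTheory.tendsto_cdf_atTop (μ.map M.Y)).const_sub 1
  rw [sub_self] at h
  exact h.congr fun y => (M.tail_eq_one_sub_cdf y).symm

/-- The law of `Y` has no atoms, so the integral of `1` against it is continuous in its upper
endpoint. -/
theorem continuous_tail (M : PacketModel μ) : Continuous M.tail := by
  have := M.nullSingletonClass_map
  have := Measure.isProbabilityMeasure_map (μ := μ) M.measurable_Y.aemeasurable
  have h := intervalIntegral.continuous_primitive (μ := μ.map M.Y) (f := fun _ => (1 : ℝ))
    (fun a b => (integrable_const (1 : ℝ)).intervalIntegrable) 0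
  have h2 : M.tail = fun y => M.tail 0 - ∫ _ in (0 : ℝ)..y, (1 : ℝ) ∂(μ.map M.Y) := by
    funext y
    rw [tail_eq_one_sub_cdf, tail_eq_one_sub_cdf, ProbabilityTheory.cdf_eq_real,
      ProbabilityTheory.cdf_eq_real]
    have := intervalIntegral.integral_Iic_sub_Iic (μ := μ.map M.Y) (f := fun _ => (1 : ℝ))
      (a := 0) (b := y) (integrable_const _).integrableOn (integrable_const _).integrableOn
    simp only [integral_const, smul_eq_mul, mul_one, measureReal_restrict_apply_univ] at this
    linarith
  rw [h2]
  exact continuous_const.sub h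

theorem exists_tail_eq (M : PacketModel μ) {x : ℝ} (hx : x ∈ Ioc (0 : ℝ) 1) :
    ∃ y, 0 ≤ y ∧ M.tail y = x := by
  obtain ⟨z, hz0, hz⟩ :=
    ((eventually_ge_atTop 0).and (M.tendsto_tail.eventually (gt_mem_nhds hx.1))).exists
  obtain ⟨y, hy, h⟩ := intermediate_value_Icc' hz0 M.continuous_tail.continuousOn
    ⟨hz.le, hx.2.trans_eq M.tail_zero.symm⟩
  exact ⟨y, hy.1, h⟩

/-- Full support makes `tail` strictly decreasing on `[0, ∞)`, so nothing above `y` lies in the set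
whose supremum is taken. -/
theorem censoringThreshold_tail (M : PacketModel μ) {y : ℝ} (hy : 0 ≤ y) (h0 : 0 < M.tail y) :
    M.censoringThreshold (M.tail y) = (y : EReal) := by
  refine le_antisymm (sSup_le fun z hz => ?_) (le_sSup ?_)
  · by_contra! hlt
    induction z with
    | bot => exact not_lt_bot hlt
    | top =>
      have h : {ω | (⊤ : EReal) ≤ (M.Y ω : EReal)} = ∅ := by
        ext ω; simp
      rw [mem_ofPred_eq, h, measureReal_empty] at hz
      exact absurd hz (not_le.2 h0)
    | coe z =>
      have h := M.tail_lt hy (EReal.coe_lt_coe_iff.1 hlt)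
      simp only [mem_ofPred_eq, EReal.coe_le_coe_iff] at hz
      exact absurd hz (not_le.2 h)
  · simp [tail]

theorem transmitSet_tail (M : PacketModel μ) {y : ℝ} (hy : 0 ≤ y) (h0 : 0 < M.tail y) :
    M.transmitSet (M.tail y) = {ω | y ≤ M.Y ω} := by
  ext ω
  simp [transmitSet, M.censoringThreshold_tail hy h0]

theorem measureReal_transmitSet (M : PacketModel μ) {x : ℝ} (hx : x ∈ Icc (0 : ℝ) 1) :
    μ.real (M.transmitSet x) = x := by
  rcases hx.1.eq_or_lt with rfl | h
  · rw [transmitSet_zero, measureReal_empty]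
  · obtain ⟨y, hy, rfl⟩ := M.exists_tail_eq ⟨h, hx.2⟩
    rw [transmitSet_tail _ hy h, tail]

/-- The decision to transmit depends on `Y` alone, so conditioning on `Y` leaves the integral
unchanged. -/
theorem IsExpectedUtility.g_eq {M : PacketModel μ} {Vbar : ℝ → ℝ}
    (h : M.IsExpectedUtility Vbar) (x : ℝ) :
    M.g x = ∫ ω in M.transmitSet x, Vbar (M.Y ω) ∂μ := by
  have h1 := setIntegral_condExp M.measurable_Y.comap_le
    (M.V_integrable.indicator M.measurableSet_decodable) (M.measurableSet_comap_transmitSet x)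
  rw [setIntegral_indicator M.measurableSet_decodable] at h1
  rw [g, ← transmitSet, ← h1]
  exact setIntegral_congr_ae (M.measurableSet_transmitSet x) (h.mono fun ω hω _ => hω)

/-- Among all events of a given probability, upper level sets of the observation are the best:
quantitative form with the supporting slope at the threshold. -/
theorem IsExpectedUtility.setIntegral_lt {M : PacketModel μ} {Vbar : ℝ → ℝ}
    (h : M.IsExpectedUtility Vbar) (hreg : RegularUtility Vbar) {y : ℝ} (hy : 0 ≤ y)
    {A : Set Ω} (hA : MeasurableSet A) (hne : μ.real A ≠ M.tail y) :
    ∫ ω in A, Vbar (M.Y ω) ∂μ <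
      ∫ ω in {ω | y ≤ M.Y ω}, Vbar (M.Y ω) ∂μ + Vbar y * (μ.real A - M.tail y) := by
  set B := {ω | y ≤ M.Y ω} with hBdef
  have hB : MeasurableSet B := M.measurableSet_le_Y y
  set f : Ω → ℝ := fun ω => Vbar (M.Y ω) - Vbar y with hf
  have hfi : Integrable f μ := h.integrable.sub (integrable_const _)
  have hset : ∀ C : Set Ω, MeasurableSet C →
      ∫ ω, C.indicator f ω ∂μ = ∫ ω in C, Vbar (M.Y ω) ∂μ - Vbar y * μ.real C := by
    intro C hC
    rw [integral_indicator hC, integral_sub h.integrable.integrableOn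
      (integrable_const _).integrableOn, setIntegral_const, smul_eq_mul, mul_comm (Vbar y)]
  have hmono := hreg.strictMonoOn_Ici
  -- Up to a null set `f` is nonnegative on `B` and nonpositive off it, so no event collects more of
  -- `f` than `B`.
  have hnn : 0 ≤ᵐ[μ] fun ω => B.indicator f ω - A.indicator f ω := by
    filter_upwards [M.Y_pos] with ω hω
    by_cases hb : y ≤ M.Y ω
    · have h0 : 0 ≤ f ω := sub_nonneg.2 (hmono.monotoneOn hy hω.le hb)
      rw [Pi.zero_apply, indicator_of_mem (show ω ∈ B from hb), sub_nonneg]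
      exact indicator_le_self' (fun _ _ => h0) ω
    · have h0 : f ω ≤ 0 := sub_nonpos.2 (hmono.monotoneOn hω.le hy (not_le.1 hb).le)
      rw [Pi.zero_apply, indicator_of_notMem (show ω ∉ B from hb), zero_sub, neg_nonneg]
      exact indicator_apply_le' (fun _ => h0) fun _ => le_rfl
  have hint : Integrable (fun ω => B.indicator f ω - A.indicator f ω) μ :=
    (hfi.indicator hB).sub (hfi.indicator hA)
  have hval : ∫ ω, (B.indicator f ω - A.indicator f ω) ∂μ =
      (∫ ω in B, Vbar (M.Y ω) ∂μ - Vbar y * M.tail y)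
        - (∫ ω in A, Vbar (M.Y ω) ∂μ - Vbar y * μ.real A) := by
    rw [integral_sub (hfi.indicator hB) (hfi.indicator hA), hset B hB, hset A hA]
    rfl
  have hpos : 0 < ∫ ω, (B.indicator f ω - A.indicator f ω) ∂μ := by
    -- Equality would force `A = B` almost everywhere, because `f` vanishes only on the null event
    -- `Y = y`.
    refine (integral_nonneg_of_ae hnn).lt_of_ne fun h0 => hne ?_
    have h1 := (integral_eq_zero_iff_of_nonneg_ae hnn hint).1 h0.symm
    refine measureReal_congr ?_
    filter_upwards [h1, M.Y_pos, M.ae_ne y] with ω hω hpos hney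
    have hfne : f ω ≠ 0 := fun h2 => hney (hmono.injOn hpos.le hy (sub_eq_zero.1 h2))
    refine propext ⟨fun ha => ?_, fun hb => ?_⟩
    · by_contra hb
      have hb' : ω ∉ B := hb
      have ha' : ω ∈ A := ha
      simp [ha', hb', hfne] at hω
    · by_contra ha
      have hb' : ω ∈ B := hb
      have ha' : ω ∉ A := ha
      simp [ha', hb', hfne] at hω
  linarith

/-- `Vbar y` is a strict supergradient of `g` at the transmission probability with threshold `y`. -/
theorem IsExpectedUtility.g_lt {M : PacketModel μ} {Vbar : ℝ → ℝ}
    (h : M.IsExpectedUtility Vbar) (hreg : RegularUtility Vbar) {y : ℝ} (hy : 0 ≤ y)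
    (h0 : 0 < M.tail y) {x : ℝ} (hx : x ∈ Icc (0 : ℝ) 1) (hne : x ≠ M.tail y) :
    M.g x < M.g (M.tail y) + Vbar y * (x - M.tail y) := by
  have hm := M.measureReal_transmitSet hx
  have := h.setIntegral_lt hreg hy (M.measurableSet_transmitSet x) (hm.trans_ne hne)
  rwa [hm, ← h.g_eq, ← transmitSet_tail _ hy h0, ← h.g_eq] at this

/-- Transmission events are nested, so those for `u` and `x` differ by measure `|u - x|`; absolute
continuity of the integral does the rest. -/
theorem IsExpectedUtility.continuousOn_g {M : PacketModel μ} {Vbar : ℝ → ℝ}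
    (h : M.IsExpectedUtility Vbar) : ContinuousOn M.g (Icc 0 1) := by
  intro x hx
  have hdiff : ∀ u ∈ Icc (0 : ℝ) 1, ∀ v ∈ Icc (0 : ℝ) 1,
      μ (M.transmitSet u \ M.transmitSet v) ≤ ENNReal.ofReal |u - v| := by
    intro u hu v hv
    rcases le_total u v with huv | huv
    · rw [sdiff_eq_empty.2 (M.transmitSet_mono huv), measure_empty]
      exact zero_le
    · rw [← ofReal_measureReal, measureReal_sdiff (M.transmitSet_mono huv)
        (M.measurableSet_transmitSet v), M.measureReal_transmitSet hu,
        M.measureReal_transmitSet hv]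
      exact ENNReal.ofReal_le_ofReal (le_abs_self _)
  have habs : Tendsto (fun u => ENNReal.ofReal |u - x|) (𝓝[Icc 0 1] x) (𝓝 0) := by
    have : Continuous fun u : ℝ => ENNReal.ofReal |u - x| :=
      ENNReal.continuous_ofReal.comp (continuous_id.sub continuous_const).abs
    have h1 := (this.tendsto x).mono_left (nhdsWithin_le_nhds (s := Icc 0 1))
    simpa using h1
  have ht1 : Tendsto (μ ∘ fun u => M.transmitSet u \ M.transmitSet x) (𝓝[Icc 0 1] x) (𝓝 0) := by
    refine tendsto_of_tendsto_of_tendsto_of_le_of_le' tendsto_const_nhds habs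
      (Eventually.of_forall fun _ => zero_le) ?_
    filter_upwards [self_mem_nhdsWithin] with u hu using hdiff u hu x hx
  have ht2 : Tendsto (μ ∘ fun u => M.transmitSet x \ M.transmitSet u) (𝓝[Icc 0 1] x) (𝓝 0) := by
    refine tendsto_of_tendsto_of_tendsto_of_le_of_le' tendsto_const_nhds habs
      (Eventually.of_forall fun _ => zero_le) ?_
    filter_upwards [self_mem_nhdsWithin] with u hu
    rw [abs_sub_comm]
    exact hdiff x hx u hu
  have h3 := ((h.integrable.tendsto_setIntegral_nhds_zero ht1).sub
    (h.integrable.tendsto_setIntegral_nhds_zero ht2)).add_const (M.g x)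
  rw [sub_zero, zero_add] at h3
  refine h3.congr fun u => ?_
  have hu := integral_inter_add_sdiff (μ := μ) (s := M.transmitSet u)
    (M.measurableSet_transmitSet x) h.integrable.integrableOn
  have hx := integral_inter_add_sdiff (μ := μ) (s := M.transmitSet x)
    (M.measurableSet_transmitSet u) h.integrable.integrableOn
  rw [h.g_eq u, h.g_eq x, ← hu, ← hx, inter_comm]
  ring

theorem IsExpectedUtility.isUtilityCurve {M : PacketModel μ} {Vbar : ℝ → ℝ}
    (h : M.IsExpectedUtility Vbar) (hreg : RegularUtility Vbar) : IsUtilityCurve M.g := by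
  have hzero : M.g 0 = 0 := by
    rw [h.g_eq, transmitSet_zero, Measure.restrict_empty, integral_zero_measure]
  have htail_pos : ∀ y, 0 ≤ y → 0 < M.tail y := fun y hy =>
    measureReal_nonneg.trans_lt (M.tail_lt hy (lt_add_one y))
  have htail_lt_one : ∀ y, 0 < y → M.tail y < 1 := fun y hy =>
    (M.tail_lt le_rfl hy).trans_eq M.tail_zero
  refine ⟨hzero, ⟨convex_Icc 0 1, ?_⟩, h.continuousOn_g, ?_, ?_, ?_⟩
  · intro a ha b hb hab s t hs ht hst
    simp only [smul_eq_mul]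
    have hc0 : 0 < s * a + t * b := by
      rcases ha.1.eq_or_lt with rfl | ha0
      · have : 0 < b := hb.1.lt_of_ne hab
        have := mul_pos ht this
        linarith
      · have := mul_pos hs ha0
        have := mul_nonneg ht.le hb.1
        linarith
    have hc1 : s * a + t * b ≤ 1 := by
      nlinarith [mul_le_mul_of_nonneg_left ha.2 hs.le, mul_le_mul_of_nonneg_left hb.2 ht.le]
    -- The strict supergradient at the convex combination, averaged over both endpoints, has its
    -- linear terms cancel.
    obtain ⟨y, hy, hyc⟩ := M.exists_tail_eq ⟨hc0, hc1⟩
    have hs' : s = 1 - t := by linarith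
    have ha' := h.g_lt hreg hy (htail_pos y hy) ha (by
      rw [hyc]; intro h'
      have : t * (b - a) = 0 := by rw [hs'] at h'; linarith
      rcases mul_eq_zero.1 this with h'' | h''
      · exact ht.ne' h''
      · exact hab (by linarith))
    have hb' := h.g_lt hreg hy (htail_pos y hy) hb (by
      rw [hyc]; intro h'
      have : s * (b - a) = 0 := by
        have : t = 1 - s := by linarith
        rw [this] at h'; linarith
      rcases mul_eq_zero.1 this with h'' | h''
      · exact hs.ne' h''
      · exact hab (by linarith))
    rw [hyc] at ha' hb'
    have e1 := mul_lt_mul_of_pos_left ha' hs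
    have e2 := mul_lt_mul_of_pos_left hb' ht
    have e3 : s * (M.g (s * a + t * b) + Vbar y * (a - (s * a + t * b)))
        + t * (M.g (s * a + t * b) + Vbar y * (b - (s * a + t * b)))
        = M.g (s * a + t * b) := by
      rw [hs']; ring
    linarith
  · intro x hx
    have := h.g_lt hreg le_rfl (htail_pos 0 le_rfl) ⟨hx.1, hx.2.le⟩
      (by rw [M.tail_zero]; exact hx.2.ne)
    rw [M.tail_zero, hreg.zero] at this
    linarith
  · intro C
    obtain ⟨y, hy0, hyC⟩ :=
      ((eventually_gt_atTop 0).and (hreg.tendsto.eventually_ge_atTop C)).exists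
    have hp := htail_pos y hy0.le
    have := h.g_lt hreg hy0.le hp (left_mem_Icc.2 zero_le_one) hp.ne
    refine ⟨M.tail y, ⟨hp, htail_lt_one y hy0⟩, ?_⟩
    have := mul_le_mul_of_nonneg_right hyC hp.le
    linarith
  · intro δ hδ
    have hc : Tendsto Vbar (𝓝[>] 0) (𝓝 (Vbar 0)) :=
      (hreg.continuous 0 self_mem_Ici).mono_left (nhdsWithin_mono _ Ioi_subset_Ici_self)
    rw [hreg.zero] at hc
    obtain ⟨y, hyδ, hy0⟩ := ((hc.eventually (gt_mem_nhds hδ)).and self_mem_nhdsWithin).exists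
    have hy0' : 0 < y := hy0
    have hlt := htail_lt_one y hy0'
    have := h.g_lt hreg hy0'.le (htail_pos y hy0'.le) (right_mem_Icc.2 zero_le_one) hlt.ne'
    refine ⟨M.tail y, ⟨htail_pos y hy0'.le, hlt⟩, ?_⟩
    have := mul_le_mul_of_nonneg_right hyδ.le (sub_nonneg.2 hlt.le)
    linarith

end PacketModel

/-! ### Perspective of the utility curve -/

/-- The perspective of `g`: the utility collected in a state of weight `a` when the weight of
transmissions in that state is `z`. -/
def persp (g : ℝ → ℝ) (a z : ℝ) : ℝ := a * g (z / a)

/-- Homogeneity, together with superadditivity, lets occupation measures be added without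
normalizing. -/
theorem persp_mul (g : ℝ → ℝ) (t a z : ℝ) : persp g (t * a) (t * z) = t * persp g a z := by
  rcases eq_or_ne t 0 with rfl | ht
  · simp [persp]
  · rw [persp, persp, mul_div_mul_left _ _ ht, mul_assoc]

theorem div_mem_Icc {a z : ℝ} (hz : 0 ≤ z) (hza : z ≤ a) : z / a ∈ Icc (0 : ℝ) 1 :=
  ⟨div_nonneg hz (hz.trans hza), div_le_one_of_le₀ hza (hz.trans hza)⟩

namespace IsUtilityCurve

variable {g : ℝ → ℝ} (hg : IsUtilityCurve g)
include hg

theorem one_pos : 0 < g 1 := by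
  have := hg.lt_one 0 ⟨le_rfl, zero_lt_one⟩
  rwa [hg.zero] at this

theorem le_one {x : ℝ} (hx : x ∈ Icc (0 : ℝ) 1) : g x ≤ g 1 := by
  rcases hx.2.eq_or_lt with rfl | h
  · exact le_rfl
  · exact (hg.lt_one x ⟨hx.1, h⟩).le

theorem mul_one_le {x : ℝ} (hx : x ∈ Icc (0 : ℝ) 1) : x * g 1 ≤ g x := by
  have := hg.strictConcaveOn.concaveOn.2 (left_mem_Icc.2 zero_le_one)
    (right_mem_Icc.2 zero_le_one) (sub_nonneg.2 hx.2) hx.1 (sub_add_cancel 1 x)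
  simpa [hg.zero] using this

theorem nonneg {x : ℝ} (hx : x ∈ Icc (0 : ℝ) 1) : 0 ≤ g x :=
  (mul_nonneg hx.1 hg.one_pos.le).trans (hg.mul_one_le hx)

theorem pos {x : ℝ} (hx : x ∈ Ioc (0 : ℝ) 1) : 0 < g x :=
  (mul_pos hx.1 hg.one_pos).trans_le (hg.mul_one_le ⟨hx.1.le, hx.2⟩)

theorem persp_zero_right (a : ℝ) : persp g a 0 = 0 := by simp [persp, hg.zero]

theorem persp_nonneg {a z : ℝ} (hz : 0 ≤ z) (hza : z ≤ a) : 0 ≤ persp g a z :=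
  mul_nonneg (hz.trans hza) (hg.nonneg (div_mem_Icc hz hza))

theorem persp_le {a z : ℝ} (hz : 0 ≤ z) (hza : z ≤ a) : persp g a z ≤ a * g 1 :=
  mul_le_mul_of_nonneg_left (hg.le_one (div_mem_Icc hz hza)) (hz.trans hza)

/-- Strict concavity of `g` at the two ratios, with weights proportional to `a` and `a'`. -/
theorem persp_add_lt {a z a' z' : ℝ} (ha : 0 < a) (hz : 0 ≤ z) (hza : z ≤ a) (ha' : 0 < a')
    (hz' : 0 ≤ z') (hza' : z' ≤ a') (hne : z / a ≠ z' / a') :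
    persp g a z + persp g a' z' < persp g (a + a') (z + z') := by
  have h := hg.strictConcaveOn.2 (div_mem_Icc hz hza) (div_mem_Icc hz' hza') hne
    (div_pos ha (add_pos ha ha')) (div_pos ha' (add_pos ha ha')) (by field_simp)
  have he : (a / (a + a')) • (z / a) + (a' / (a + a')) • (z' / a') = (z + z') / (a + a') := by
    simp only [smul_eq_mul]
    field_simp
  rw [he] at h
  have h2 := mul_lt_mul_of_pos_left h (add_pos ha ha')
  refine lt_of_eq_of_lt ?_ h2
  simp only [persp, smul_eq_mul]
  field_simp

theorem persp_add_le {a z a' z' : ℝ} (hz : 0 ≤ z) (hza : z ≤ a)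
    (hz' : 0 ≤ z') (hza' : z' ≤ a') :
    persp g a z + persp g a' z' ≤ persp g (a + a') (z + z') := by
  rcases (hz.trans hza).eq_or_lt with rfl | ha
  · obtain rfl : z = 0 := le_antisymm hza hz
    simp [persp]
  rcases (hz'.trans hza').eq_or_lt with rfl | ha'
  · obtain rfl : z' = 0 := le_antisymm hza' hz'
    simp [persp]
  by_cases h : z / a = z' / a'
  · have he : (z + z') / (a + a') = z / a := by
      rw [div_eq_div_iff ha.ne' ha'.ne'] at h
      rw [div_eq_div_iff (add_pos ha ha').ne' ha.ne']
      linear_combination -h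
    rw [persp, persp, persp, he, ← h, add_mul]
  · exact (hg.persp_add_lt ha hz hza ha' hz' hza' h).le

/-- Only the apex `(0, 0)` needs care; there boundedness of `g` squeezes the value between `0` and
`a * g 1`. -/
theorem continuousOn_persp :
    ContinuousOn (fun x : ℝ × ℝ => persp g x.1 x.2) {x | 0 ≤ x.2 ∧ x.2 ≤ x.1} := by
  rintro ⟨a, z⟩ ⟨hz, hza⟩
  rcases (hz.trans hza).eq_or_lt with rfl | ha
  · obtain rfl : z = 0 := le_antisymm hza hz
    have h0 : persp g 0 0 = 0 := hg.persp_zero_right 0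
    have hlim : Tendsto (fun x : ℝ × ℝ => x.1 * g 1)
        (𝓝[{x | 0 ≤ x.2 ∧ x.2 ≤ x.1}] (0, 0)) (𝓝 0) := by
      have : Continuous fun x : ℝ × ℝ => x.1 * g 1 := by fun_prop
      simpa using (this.tendsto (0, 0)).mono_left nhdsWithin_le_nhds
    rw [ContinuousWithinAt, h0]
    refine tendsto_of_tendsto_of_tendsto_of_le_of_le' tendsto_const_nhds hlim ?_ ?_
    · filter_upwards [self_mem_nhdsWithin] with x hx using hg.persp_nonneg hx.1 hx.2
    · filter_upwards [self_mem_nhdsWithin] with x hx using hg.persp_le hx.1 hx.2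
  · have hdiv : ContinuousWithinAt (fun x : ℝ × ℝ => x.2 / x.1)
        {x | 0 ≤ x.2 ∧ x.2 ≤ x.1} (a, z) :=
      continuousWithinAt_snd.div continuousWithinAt_fst ha.ne'
    exact continuousWithinAt_fst.mul
      ((hg.continuousOn _ (div_mem_Icc hz hza)).comp (f := fun x : ℝ × ℝ => x.2 / x.1)
        (t := Icc 0 1) hdiv fun x hx => div_mem_Icc hx.1 hx.2)

end IsUtilityCurve

/-! ### Occupation measures -/

variable {m : ℕ}

/-- `p e` is the (not necessarily normalized) weight of energy level `e` and `z e` the weight of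
transmissions from that level, for some stationary regime of the battery. -/
structure IsOccupation (b : ℝ) (p z : Fin (m + 1) → ℝ) : Prop where
  zero : z 0 = 0
  nonneg : ∀ e, 0 ≤ z e
  le : ∀ e, z e ≤ p e
  flow : ∀ i : Fin m, b * (p i.castSucc - z i.castSucc) = (1 - b) * z i.succ

/-- Total utility of an occupation measure. -/
def occUtility (g : ℝ → ℝ) (p z : Fin (m + 1) → ℝ) : ℝ :=
  ∑ i : Fin m, persp g (p i.succ) (z i.succ)

/-- Total transmission rate of an occupation measure. -/
def occRate (z : Fin (m + 1) → ℝ) : ℝ := ∑ i : Fin m, z i.succ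

theorem occUtility_mul (g : ℝ → ℝ) (t : ℝ) (p z : Fin (m + 1) → ℝ) :
    occUtility g (fun e => t * p e) (fun e => t * z e) = t * occUtility g p z := by
  simp only [occUtility, persp_mul, Finset.mul_sum]

theorem occRate_mul (t : ℝ) (z : Fin (m + 1) → ℝ) :
    occRate (fun e => t * z e) = t * occRate z := by
  simp only [occRate, Finset.mul_sum]

theorem occRate_add (z w : Fin (m + 1) → ℝ) :
    occRate (fun e => z e + w e) = occRate z + occRate w := by
  simp only [occRate, Finset.sum_add_distrib]

namespace IsOccupation

variable {b : ℝ} {p z q w : Fin (m + 1) → ℝ}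

theorem nonneg_fst (h : IsOccupation b p z) (e : Fin (m + 1)) : 0 ≤ p e :=
  (h.nonneg e).trans (h.le e)

theorem mul (h : IsOccupation b p z) {t : ℝ} (ht : 0 ≤ t) :
    IsOccupation b (fun e => t * p e) (fun e => t * z e) where
  zero := by rw [h.zero, mul_zero]
  nonneg e := mul_nonneg ht (h.nonneg e)
  le e := mul_le_mul_of_nonneg_left (h.le e) ht
  flow i := by linear_combination t * h.flow i

theorem add (h : IsOccupation b p z) (h' : IsOccupation b q w) :
    IsOccupation b (fun e => p e + q e) (fun e => z e + w e) where
  zero := by rw [h.zero, h'.zero, add_zero]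
  nonneg e := add_nonneg (h.nonneg e) (h'.nonneg e)
  le e := add_le_add (h.le e) (h'.le e)
  flow i := by linear_combination h.flow i + h'.flow i

/-- Energy conservation, from summing the balance equations: arrivals are lost only in a full
battery that stays silent. -/
theorem occRate_eq (h : IsOccupation b p z) (hp : ∑ e, p e = 1) :
    occRate z = b - b * (p (Fin.last m) - z (Fin.last m)) := by
  have h1 : ∑ i : Fin m, b * (p i.castSucc - z i.castSucc) = ∑ i : Fin m, (1 - b) * z i.succ :=
    Finset.sum_congr rfl fun i _ => h.flow i
  rw [← Finset.mul_sum, ← Finset.mul_sum, Finset.sum_sub_distrib] at h1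
  have h2 := Fin.sum_univ_castSucc p
  have h3 := Fin.sum_univ_castSucc z
  have h4 := Fin.sum_univ_succ z
  rw [h.zero] at h4
  rw [occRate]
  rw [hp] at h2
  have h5 : ∑ i : Fin m, p i.castSucc = 1 - p (Fin.last m) := by linarith
  have h6 : ∑ i : Fin m, z i.castSucc = ∑ i : Fin m, z i.succ - z (Fin.last m) := by linarith
  rw [h5, h6] at h1
  linear_combination -h1

theorem occRate_le (h : IsOccupation b p z) (hb : 0 ≤ b) (hp : ∑ e, p e = 1) :
    occRate z ≤ b := by
  rw [h.occRate_eq hp]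
  have := mul_nonneg hb (sub_nonneg.2 (h.le (Fin.last m)))
  linarith

theorem occUtility_nonneg {g : ℝ → ℝ} (hg : IsUtilityCurve g) (h : IsOccupation b p z) :
    0 ≤ occUtility g p z :=
  Finset.sum_nonneg fun _ _ => hg.persp_nonneg (h.nonneg _) (h.le _)

/-- Superadditivity of the utility, keeping track of the gain at one energy level. -/
theorem add_gain_le {g : ℝ → ℝ} (hg : IsUtilityCurve g) (h : IsOccupation b p z)
    (h' : IsOccupation b q w) (i : Fin m) :
    occUtility g p z + occUtility g q w + (persp g (p i.succ + q i.succ) (z i.succ + w i.succ)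
      - persp g (p i.succ) (z i.succ) - persp g (q i.succ) (w i.succ)) ≤
    occUtility g (fun e => p e + q e) (fun e => z e + w e) := by
  have h1 := Finset.single_le_sum (s := Finset.univ) (a := i)
    (f := fun i : Fin m => persp g (p i.succ + q i.succ) (z i.succ + w i.succ)
      - persp g (p i.succ) (z i.succ) - persp g (q i.succ) (w i.succ))
    (fun j _ => by
      have := hg.persp_add_le (h.nonneg j.succ) (h.le j.succ) (h'.nonneg j.succ) (h'.le j.succ)
      linarith) (Finset.mem_univ i)
  simp only [Finset.sum_sub_distrib] at h1
  unfold occUtility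
  linarith

theorem occUtility_add_le {g : ℝ → ℝ} (hg : IsUtilityCurve g) (h : IsOccupation b p z)
    (h' : IsOccupation b q w) :
    occUtility g p z + occUtility g q w ≤
      occUtility g (fun e => p e + q e) (fun e => z e + w e) := by
  unfold occUtility
  rw [← Finset.sum_add_distrib]
  exact Finset.sum_le_sum fun _ _ =>
    hg.persp_add_le (h.nonneg _) (h.le _) (h'.nonneg _) (h'.le _)

/-- If every positive energy level without transmissions carries no weight, then level `0` has
positive weight. -/
theorem zero_pos (h : IsOccupation b p z) (hb : b < 1) (hp : ∑ e, p e = 1)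
    (hz : ∀ i : Fin m, z i.succ = 0 → p i.succ = 0) : 0 < p 0 := by
  refine (h.nonneg_fst 0).lt_of_ne' fun h0 => ?_
  have hall : ∀ e, p e = 0 := by
    intro e
    induction e using Fin.induction with
    | zero => exact h0
    | succ i ih =>
      have hzi : z i.castSucc = 0 := le_antisymm (ih ▸ h.le _) (h.nonneg _)
      have hf := h.flow i
      rw [ih, hzi, sub_zero, mul_zero] at hf
      exact hz i ((mul_eq_zero.1 hf.symm).resolve_left (sub_pos.2 hb).ne')
  simp [hall] at hp

end IsOccupation

/-! ### Maximizers at a fixed price avoid the excluded faces of the polytope. -/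

/-- The normalized occupation measure `(p, z)` maximizes the utility with price `c` on
transmissions. -/
structure IsPricedMax (g : ℝ → ℝ) (b c : ℝ) (p z : Fin (m + 1) → ℝ) : Prop where
  occ : IsOccupation b p z
  sum_eq_one : ∑ e, p e = 1
  max : ∀ q w : Fin (m + 1) → ℝ, IsOccupation b q w → ∑ e, q e = 1 →
    occUtility g q w - c * occRate w ≤ occUtility g p z - c * occRate z

namespace IsPricedMax

variable {g : ℝ → ℝ} {b c : ℝ} {p z q w : Fin (m + 1) → ℝ}

/-- Optimality tested against `(p + t q) / (1 + t)`, with the normalization cleared by homogeneity.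
-/
theorem add_mul_le (h : IsPricedMax g b c p z) (hq : IsOccupation b q w) (hq1 : ∑ e, q e = 1)
    {t : ℝ} (ht : 0 ≤ t) :
    occUtility g (fun e => p e + t * q e) (fun e => z e + t * w e)
      - c * (occRate z + t * occRate w) ≤ (1 + t) * (occUtility g p z - c * occRate z) := by
  have hs : 0 < 1 + t := by linarith
  have hadd := h.occ.add (hq.mul ht)
  have h1 := h.max _ _ (hadd.mul (inv_nonneg.2 hs.le)) (by
    rw [← Finset.mul_sum, Finset.sum_add_distrib, ← Finset.mul_sum, h.sum_eq_one, hq1, mul_one,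
      inv_mul_cancel₀ hs.ne'])
  rw [occUtility_mul, occRate_mul, occRate_add z, occRate_mul, mul_left_comm, ← mul_sub,
    inv_mul_le_iff₀ hs] at h1
  exact h1

variable (hg : IsUtilityCurve g)
include hg

/-- Mixing in a little of a regime that transmits everywhere costs an amount linear in the mixing
weight, while the unbounded slope of `g` at `0` yields a gain steeper than any linear bound. -/
theorem fst_eq_zero_of_snd_eq_zero (h : IsPricedMax g b c p z) (hq : IsOccupation b q w)
    (hq1 : ∑ e, q e = 1) (hw : ∀ i : Fin m, 0 < w i.succ) (i : Fin m) (hz : z i.succ = 0) :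
    p i.succ = 0 := by
  by_contra hne
  have hp : 0 < p i.succ := (h.occ.nonneg_fst _).lt_of_ne' hne
  have hwi := hw i
  obtain ⟨x, hx, hxg⟩ := hg.slope_zero
    ((occUtility g p z - c * occRate z + c * occRate w) / w i.succ)
  -- With this `t` the added transmissions are the fraction `x` of the weight `p i.succ`. The slope
  -- chosen above is exactly the one that contradicts `h6`.
  set t := x * p i.succ / w i.succ with ht
  have ht0 : 0 < t := div_pos (mul_pos hx.1 hp) hwi
  have htw : t * w i.succ = x * p i.succ := by rw [ht]; field_simp
  have h1 := h.add_mul_le hq hq1 ht0.le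
  have hqt := hq.mul ht0.le
  have h2 := h.occ.add_gain_le hg hqt i
  have h3 := hg.persp_add_le (a := p i.succ) (z := t * w i.succ) (a' := t * q i.succ) (z' := 0)
    (mul_nonneg ht0.le hwi.le) (by rw [htw]; nlinarith [hx.2]) le_rfl (hqt.nonneg_fst _)
  rw [add_zero, hg.persp_zero_right, add_zero] at h3
  have h4 : persp g (p i.succ) (t * w i.succ) = p i.succ * g x := by
    rw [persp, htw, mul_div_cancel_right₀ _ hne]
  have h5 : persp g (t * q i.succ) (t * w i.succ) ≤
      occUtility g (fun e => t * q e) (fun e => t * w e) :=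
    Finset.single_le_sum (s := Finset.univ) (a := i)
      (f := fun i : Fin m => persp g (t * q i.succ) (t * w i.succ))
      (fun j _ => hg.persp_nonneg (hqt.nonneg _) (hqt.le _)) (Finset.mem_univ i)
  rw [hz, zero_add, hg.persp_zero_right] at h2
  have h6 : p i.succ * g x ≤ t * (occUtility g p z - c * occRate z + c * occRate w) := by
    linarith
  have h7 := mul_lt_mul_of_pos_left hxg hp
  have h8 : p i.succ * ((occUtility g p z - c * occRate z + c * occRate w) / w i.succ * x)
      = t * (occUtility g p z - c * occRate z + c * occRate w) := by
    rw [ht]; field_simp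
  linarith

theorem occUtility_lt_one (h : IsPricedMax g b c p z) (h0 : 0 < p 0) :
    occUtility g p z < g 1 := by
  have h1 : occUtility g p z ≤ ∑ i : Fin m, p i.succ * g 1 :=
    Finset.sum_le_sum fun i _ => hg.persp_le (h.occ.nonneg _) (h.occ.le _)
  rw [← Finset.sum_mul] at h1
  have h2 := Fin.sum_univ_succ p
  rw [h.sum_eq_one] at h2
  have h3 : ∑ i : Fin m, p i.succ = 1 - p 0 := by linarith
  rw [h3] at h1
  have := mul_pos h0 hg.one_pos
  linarith

/-- A regime that always transmits at some level below the capacity, hence never uses the rest of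
the battery, is not optimal. -/
theorem snd_lt_fst (h : IsPricedMax g b c p z) (hb : b ∈ Ioo (0 : ℝ) 1)
    (hz : ∀ i : Fin m, z i.succ = 0 → p i.succ = 0) (i : Fin m) (hp : 0 < p i.castSucc) :
    z i.castSucc < p i.castSucc := by
  refine (h.occ.le _).lt_of_ne fun heq => ?_
  have hb1 : 0 < 1 - b := sub_pos.2 hb.2
  have h0 := h.occ.zero_pos hb.2 h.sum_eq_one hz
  have hne0 : i.castSucc ≠ 0 := by
    intro hi
    rw [hi, h.occ.zero] at heq
    exact h0.ne heq
  -- Certain transmission at level `i` blocks upward flow, so the levels above are empty, no energy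
  -- overflows, and the rate equals `b`.
  have habove : ∀ e : Fin (m + 1), i.castSucc < e → p e = 0 := by
    intro e
    induction e using Fin.induction with
    | zero => intro hlt; exact absurd hlt (Fin.not_lt_zero _)
    | succ j ih =>
      intro hlt
      have hpz : p j.castSucc = z j.castSucc := by
        rcases (Fin.le_castSucc_iff.2 hlt).eq_or_lt with hij | hij
        · rw [← hij, heq]
        · have := ih hij
          exact le_antisymm (this ▸ h.occ.nonneg _) (h.occ.le _)
      have hf := h.occ.flow j
      rw [hpz, sub_self, mul_zero] at hf
      exact hz j ((mul_eq_zero.1 hf.symm).resolve_left hb1.ne')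
  have hlast : p (Fin.last m) = 0 := habove _ (Fin.castSucc_lt_last i)
  have hzlast : z (Fin.last m) = 0 := le_antisymm (hlast ▸ h.occ.le _) (h.occ.nonneg _)
  have hrate : occRate z = b := by
    rw [h.occ.occRate_eq h.sum_eq_one, hlast, hzlast]; ring
  obtain ⟨k, hk⟩ := Fin.exists_succ_eq.2 hne0
  have hik : i.succ ≠ i.castSucc := Fin.castSucc_lt_succ.ne'
  -- Comparison regime: silent at level `i`, certain to transmit at `i + 1`. Its rate is also `b`,
  -- so the price terms cancel, and its utility is at least `b * g 1`.
  set q : Fin (m + 1) → ℝ :=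
    fun e => (if e = i.castSucc then 1 - b else 0) + if e = i.succ then b else 0 with hqdef
  set w : Fin (m + 1) → ℝ := fun e => if e = i.succ then b else 0 with hwdef
  have hq : IsOccupation b q w := by
    refine ⟨if_neg (Fin.succ_ne_zero i).symm, fun e => ?_, fun e => ?_, fun j => ?_⟩
    · simp only [hwdef]; split_ifs
      exacts [hb.1.le, le_rfl]
    · simp only [hqdef, hwdef]
      have : (0 : ℝ) ≤ if e = i.castSucc then 1 - b else 0 := by
        split_ifs
        exacts [hb1.le, le_rfl]
      linarith
    · simp only [hqdef, hwdef, Fin.castSucc_inj, Fin.succ_inj, add_sub_cancel_right]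
      split_ifs <;> ring
  have hq1 : ∑ e, q e = 1 := by
    simp [hqdef, Finset.sum_add_distrib]
  have hwr : occRate w = b := by
    simp [hwdef, occRate]
  have hqu : b * g 1 ≤ occUtility g q w := by
    have := Finset.single_le_sum (s := Finset.univ) (a := i)
      (f := fun i : Fin m => persp g (q i.succ) (w i.succ))
      (fun j _ => hg.persp_nonneg (hq.nonneg _) (hq.le _)) (Finset.mem_univ i)
    have h2 : persp g (q i.succ) (w i.succ) = b * g 1 := by
      simp [hqdef, hwdef, hik, persp, hb.1.ne']
    rw [← h2]
    exact this
  have hGlt := h.occUtility_lt_one hg h0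
  obtain ⟨x, hx, hxg⟩ := hg.slope_one (g 1 - occUtility g p z) (sub_pos.2 hGlt)
  set a := p i.castSucc with ha
  -- Silent weight `t * (1 - b)` lowers the transmission ratio at level `i` from `1` to `x`. As `g`
  -- is nearly flat at `1`, the change in utility there is at least `t * (1 - b)` times the current
  -- utility; the further `t * b * g 1` then breaks optimality.
  set t := a * (1 - x) / (x * (1 - b)) with ht
  have hx0 := hx.1
  have hx1 : 0 < 1 - x := sub_pos.2 hx.2
  have ht0 : 0 < t := div_pos (mul_pos hp hx1) (mul_pos hx0 hb1)
  have h1 := h.add_mul_le hq hq1 ht0.le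
  have h2 := h.occ.add_gain_le hg (hq.mul ht0.le) k
  have hqk : q i.castSucc = 1 - b := by simp [hqdef, hik.symm]
  have hwk : w i.castSucc = 0 := by simp [hwdef, hik.symm]
  rw [hk, heq, hqk, hwk, mul_zero, add_zero, hg.persp_zero_right, occUtility_mul, ← ha] at h2
  have hax : a + t * (1 - b) = a / x := by rw [ht]; field_simp; ring
  have h3 : persp g (a + t * (1 - b)) a = a / x * g x := by
    rw [hax, persp, div_div_cancel₀ hp.ne']
  have h4 : persp g a a = a * g 1 := by rw [persp, div_self hp.ne']
  rw [h3, h4] at h2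
  rw [hwr, hrate] at h1
  have h5 := mul_le_mul_of_nonneg_left hqu ht0.le
  have h6 : a / x * (g 1 - g x) ≤ a / x * ((g 1 - occUtility g p z) * (1 - x)) :=
    mul_le_mul_of_nonneg_left hxg (div_pos hp hx0).le
  have h7 : a / x * (1 - x) = t * (1 - b) := by rw [ht]; field_simp
  have h8 : a / x * ((g 1 - occUtility g p z) * (1 - x))
      = t * (1 - b) * (g 1 - occUtility g p z) := by rw [← h7]; ring
  have h9 : a / x * g 1 - a * g 1 = t * (1 - b) * g 1 := by rw [← hax]; ring
  have h10 : t * (b * (g 1 - occUtility g p z)) ≤ 0 := by nlinarith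
  have := mul_pos ht0 (mul_pos hb.1 (sub_pos.2 hGlt))
  linarith

theorem fst_pos (h : IsPricedMax g b c p z) (hb : b ∈ Ioo (0 : ℝ) 1)
    (hz : ∀ i : Fin m, z i.succ = 0 → p i.succ = 0) (e : Fin (m + 1)) : 0 < p e := by
  induction e using Fin.induction with
  | zero => exact h.occ.zero_pos hb.2 h.sum_eq_one hz
  | succ i ih =>
    have h1 := h.snd_lt_fst hg hb hz i ih
    have hf := h.occ.flow i
    refine (h.occ.nonneg_fst _).lt_of_ne' fun h0 => ?_
    have hzi : z i.succ = 0 := le_antisymm (h0 ▸ h.occ.le _) (h.occ.nonneg _)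
    rw [hzi, mul_zero] at hf
    exact (mul_pos hb.1 (sub_pos.2 h1)).ne' hf

/-- If the competitor did equally well, the midpoint would do strictly better, by strict
superadditivity at level `i`. -/
theorem lt_of_ne (h : IsPricedMax g b c p z) (hp : ∀ e, 0 < p e) (hq : IsOccupation b q w)
    (hq1 : ∑ e, q e = 1) (hqpos : ∀ e, 0 < q e) (i : Fin m)
    (hne : z i.succ / p i.succ ≠ w i.succ / q i.succ) :
    occUtility g q w - c * occRate w < occUtility g p z - c * occRate z := by
  have h1 := h.add_mul_le hq hq1 zero_le_one
  have h2 := h.occ.add_gain_le hg hq i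
  have h3 := hg.persp_add_lt (hp i.succ) (h.occ.nonneg _) (h.occ.le _) (hqpos i.succ)
    (hq.nonneg _) (hq.le _) hne
  simp only [one_mul] at h1
  linarith

end IsPricedMax

/-! ### A maximizer of the network utility is an equilibrium -/

/-- The normalized occupation measures. -/
def occPolytope (m : ℕ) (b : ℝ) : Set ((Fin (m + 1) → ℝ) × (Fin (m + 1) → ℝ)) :=
  {x | IsOccupation b x.1 x.2 ∧ ∑ e, x.1 e = 1}

theorem isCompact_occPolytope (m : ℕ) (b : ℝ) : IsCompact (occPolytope m b) := by
  have hcl : IsClosed (occPolytope m b) := by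
    have : occPolytope m b = {x | x.2 0 = 0} ∩ (⋂ e, {x | 0 ≤ x.2 e}) ∩ (⋂ e, {x | x.2 e ≤ x.1 e})
        ∩ (⋂ i : Fin m, {x | b * (x.1 i.castSucc - x.2 i.castSucc) = (1 - b) * x.2 i.succ})
        ∩ {x | ∑ e, x.1 e = 1} := by
      ext x
      simp only [occPolytope, mem_ofPred_eq, mem_inter_iff, mem_iInter]
      exact ⟨fun ⟨h, h1⟩ => ⟨⟨⟨⟨h.zero, h.nonneg⟩, h.le⟩, h.flow⟩, h1⟩,
        fun ⟨⟨⟨⟨h0, hn⟩, hl⟩, hf⟩, h1⟩ => ⟨⟨h0, hn, hl, hf⟩, h1⟩⟩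
    rw [this]
    refine ((((isClosed_eq ?_ ?_).inter (isClosed_iInter fun e => isClosed_le ?_ ?_)).inter
      (isClosed_iInter fun e => isClosed_le ?_ ?_)).inter
      (isClosed_iInter fun i => isClosed_eq ?_ ?_)).inter (isClosed_eq ?_ ?_) <;> fun_prop
  refine (isCompact_Icc (a := ((0, 0) : (Fin (m + 1) → ℝ) × (Fin (m + 1) → ℝ)))
    (b := (1, 1))).of_isClosed_subset hcl ?_
  rintro ⟨p, z⟩ ⟨h, h1⟩
  have hp1 : ∀ e, p e ≤ 1 := fun e => by
    rw [← h1]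
    exact Finset.single_le_sum (f := p) (fun j _ => h.nonneg_fst j) (Finset.mem_univ e)
  exact ⟨⟨h.nonneg_fst, h.nonneg⟩, ⟨hp1, fun e => (h.le e).trans (hp1 e)⟩⟩

theorem IsUtilityCurve.continuousOn_occUtility {g : ℝ → ℝ} (hg : IsUtilityCurve g) (m : ℕ)
    (b : ℝ) : ContinuousOn (fun x : (Fin (m + 1) → ℝ) × (Fin (m + 1) → ℝ) =>
      occUtility g x.1 x.2) (occPolytope m b) := by
  unfold occUtility
  refine continuousOn_finsetSum _ fun i _ => ?_
  exact hg.continuousOn_persp.comp (f := fun x : (Fin (m + 1) → ℝ) × (Fin (m + 1) → ℝ) =>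
    (x.1 i.succ, x.2 i.succ)) (by fun_prop) fun x hx => ⟨hx.1.nonneg _, hx.1.le _⟩

/-- First-order optimality for a product `G * K ^ n` that is maximal at `t = 0` along a segment. -/
theorem le_of_mul_pow_le {G K A B : ℝ} (n : ℕ) (hG : 0 ≤ G) (hK : 0 < K) (hGA : 0 ≤ G + A)
    (hKB : 0 ≤ K - B)
    (h : ∀ t ∈ Ioc (0 : ℝ) 1, (G + t * A) * (K - t * B) ^ n ≤ G * K ^ n) :
    A ≤ n * G / K * B := by
  by_contra! hlt
  set D := A - n * G / K * B with hD
  set E := n * A * B / K with hE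
  have hD0 : 0 < D := sub_pos.2 hlt
  have key : ∀ t ∈ Ioc (0 : ℝ) 1, D ≤ t * E := by
    intro t ht
    have h1 : 0 ≤ G + t * A := by nlinarith [ht.1, ht.2]
    have h2 : K - t * B = K * (1 + -(t * B / K)) := by field_simp; ring
    have h3 : -2 ≤ -(t * B / K) := by
      rw [neg_le_neg_iff, div_le_iff₀ hK]
      nlinarith [ht.1, ht.2]
    have h4 := h t ht
    rw [h2, mul_pow] at h4
    -- Bernoulli's inequality replaces differentiation; after division by `t` it leaves `D ≤ t * E`,
    -- which fails at `t = D / (2 * E)`.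
    have h5 := mul_le_mul_of_nonneg_left (one_add_mul_le_pow h3 n)
      (mul_nonneg h1 (pow_pos hK n).le)
    have h6 : (G + t * A) * (1 + n * -(t * B / K)) ≤ G := by
      refine le_of_mul_le_mul_right ?_ (pow_pos hK n)
      calc _ = (G + t * A) * K ^ n * (1 + n * -(t * B / K)) := by ring
        _ ≤ _ := h5
        _ = (G + t * A) * (K ^ n * (1 + -(t * B / K)) ^ n) := by ring
        _ ≤ _ := h4
    have h7 : (G + t * A) * (1 + n * -(t * B / K)) - G = t * (D - t * E) := by
      rw [hD, hE]; field_simp; ring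
    have h8 : t * (D - t * E) ≤ 0 := by linarith
    by_contra! hc
    exact absurd (mul_pos ht.1 (sub_pos.2 hc)) (not_lt.2 h8)
  have hE0 : 0 < E := by
    have := key 1 ⟨one_pos, le_rfl⟩
    linarith
  have hDE : D ≤ E := by simpa using key 1 ⟨one_pos, le_rfl⟩
  have := key (D / (2 * E)) ⟨by positivity, by rw [div_le_one (by positivity)]; linarith⟩
  have h9 : D / (2 * E) * E = D / 2 := by field_simp
  linarith

/-- There is an occupation measure that is optimal for the price given by its own multiplier. -/
theorem exists_isPricedMax {g : ℝ → ℝ} (hg : IsUtilityCurve g) {b : ℝ} (hb : b ∈ Ioo (0 : ℝ) 1)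
    (n : ℕ) {q w : Fin (m + 1) → ℝ} (hq : IsOccupation b q w) (hq1 : ∑ e, q e = 1)
    (hqpos : 0 < occUtility g q w) :
    ∃ p z : Fin (m + 1) → ℝ, 0 < occUtility g p z ∧
      IsPricedMax g b (n * occUtility g p z / (1 - occRate z)) p z := by
  -- A potential for the equilibrium condition: the derivative of its logarithm is proportional to
  -- `dG - n * G / (1 - P) * dP`.
  have hcont : ContinuousOn (fun x : (Fin (m + 1) → ℝ) × (Fin (m + 1) → ℝ) =>
      occUtility g x.1 x.2 * (1 - occRate x.2) ^ n) (occPolytope m b) := by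
    refine (hg.continuousOn_occUtility m b).mul (Continuous.continuousOn ?_)
    unfold occRate
    fun_prop
  obtain ⟨⟨p, z⟩, ⟨hp, hp1⟩, hmax⟩ :=
    (isCompact_occPolytope m b).exists_isMaxOn ⟨(q, w), hq, hq1⟩ hcont
  have hrate : ∀ {q w : Fin (m + 1) → ℝ}, IsOccupation b q w → ∑ e, q e = 1 →
      0 < 1 - occRate w := fun h h1 => by
    have := h.occRate_le hb.1.le h1
    linarith [hb.2]
  have hpos : 0 < occUtility g p z := by
    have h1 := isMaxOn_iff.1 hmax (q, w) ⟨hq, hq1⟩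
    exact pos_of_mul_pos_left ((mul_pos hqpos (pow_pos (hrate hq hq1) n)).trans_le h1)
      (pow_pos (hrate hp hp1) n).le
  refine ⟨p, z, hpos, hp, hp1, fun q w hq hq1 => ?_⟩
  have key := le_of_mul_pow_le n (A := occUtility g q w - occUtility g p z)
    (B := occRate w - occRate z) hpos.le (hrate hp hp1)
    (by rw [add_sub_cancel]; exact hq.occUtility_nonneg hg)
    (by have := hrate hq hq1; linarith) ?_
  · linarith
  · intro t ht
    have ht1 : 0 ≤ 1 - t := sub_nonneg.2 ht.2
    have ho := (hp.mul ht1).add (hq.mul ht.1.le)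
    have hs : ∑ e, ((1 - t) * p e + t * q e) = 1 := by
      rw [Finset.sum_add_distrib, ← Finset.mul_sum, ← Finset.mul_sum, hp1, hq1]; ring
    have h1 := isMaxOn_iff.1 hmax (_, _) ⟨ho, hs⟩
    refine le_trans ?_ h1
    have hr : 1 - occRate z - t * (occRate w - occRate z)
        = 1 - occRate (fun e => (1 - t) * z e + t * w e) := by
      rw [occRate_add (fun e => (1 - t) * z e), occRate_mul, occRate_mul]; ring
    rw [hr]
    refine mul_le_mul_of_nonneg_right ?_ (pow_pos (hrate ho hs) n).le
    refine le_trans (le_of_eq ?_) ((hp.mul ht1).occUtility_add_le hg (hq.mul ht.1.le))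
    rw [occUtility_mul, occUtility_mul]; ring

/-! ### Occupation measures of admissible policies -/

namespace Admissible

variable {m : ℕ} {η : Fin (m + 1) → ℝ}

theorem succ_pos (h : Admissible η) (i : Fin m) : 0 < η i.succ := by
  by_cases hi : i.succ = Fin.last m
  · rw [hi]; exact h.2.1.1
  · exact (h.2.2 _ (Fin.succ_ne_zero i) hi).1

theorem castSucc_lt_one (h : Admissible η) (i : Fin m) : η i.castSucc < 1 := by
  by_cases hi : i.castSucc = 0
  · rw [hi, h.1]; exact one_pos
  · exact (h.2.2 _ hi (Fin.castSucc_lt_last i).ne).2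

theorem mem_Icc (h : Admissible η) (e : Fin (m + 1)) : η e ∈ Icc (0 : ℝ) 1 := by
  by_cases h0 : e = 0
  · rw [h0, h.1]; exact left_mem_Icc.2 zero_le_one
  by_cases hl : e = Fin.last m
  · rw [hl]; exact ⟨h.2.1.1.le, h.2.1.2⟩
  · exact ⟨(h.2.2 e h0 hl).1.le, (h.2.2 e h0 hl).2.le⟩

variable {b : ℝ} (hb : b ∈ Ioo (0 : ℝ) 1)
include hb

theorem steadyState_eq (h : Admissible η) {p : Fin (m + 1) → ℝ} (hp : IsSteadyState b η p) :
    steadyState b η = p :=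
  (existsUnique_steadyState hb h).unique (isSteadyState_steadyState hb h) hp

theorem sum_steadyState (h : Admissible η) : ∑ e, steadyState b η e = 1 :=
  (isSteadyState_steadyState hb h).1.2

theorem cutFlow_steadyState (h : Admissible η) (i : Fin m) :
    b * (1 - η i.castSucc) * steadyState b η i.castSucc
      = (1 - b) * η i.succ * steadyState b η i.succ :=
  sub_eq_zero.1 (((isSteadyState_iff h.1).1 (isSteadyState_steadyState hb h)).2 i)

theorem steadyState_pos (h : Admissible η) (e : Fin (m + 1)) : 0 < steadyState b η e := by
  have hnn : ∀ e, 0 ≤ steadyState b η e := (isSteadyState_steadyState hb h).1.1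
  have hcut := h.cutFlow_steadyState hb
  have hb1 : 0 < 1 - b := sub_pos.2 hb.2
  induction e using Fin.induction with
  | zero =>
    refine (hnn 0).lt_of_ne' fun h0 => ?_
    have hall : ∀ e, steadyState b η e = 0 := by
      intro e
      induction e using Fin.induction with
      | zero => exact h0
      | succ i ih =>
        have := hcut i
        rw [ih, mul_zero] at this
        exact (mul_eq_zero.1 this.symm).resolve_left (mul_pos hb1 (h.succ_pos i)).ne'
    have := h.sum_steadyState hb
    simp [hall] at this
  | succ i ih =>
    have h1 : 0 < b * (1 - η i.castSucc) * steadyState b η i.castSucc :=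
      mul_pos (mul_pos hb.1 (sub_pos.2 (h.castSucc_lt_one i))) ih
    rw [hcut i] at h1
    exact pos_of_mul_pos_right h1 (mul_pos hb1 (h.succ_pos i)).le

theorem isOccupation (h : Admissible η) :
    IsOccupation b (steadyState b η) fun e => steadyState b η e * η e where
  zero := by rw [h.1, mul_zero]
  nonneg e := mul_nonneg (h.steadyState_pos hb e).le (h.mem_Icc e).1
  le e := mul_le_of_le_one_right (h.steadyState_pos hb e).le (h.mem_Icc e).2
  flow i := by linear_combination h.cutFlow_steadyState hb i

theorem occUtility_eq {Ω : Type*} [MeasurableSpace Ω] {μ : Measure Ω} (M : PacketModel μ)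
    (h : Admissible η) :
    occUtility M.g (steadyState b η) (fun e => steadyState b η e * η e) = avgUtility M b η := by
  refine Finset.sum_congr rfl fun i _ => ?_
  rw [persp, mul_div_cancel_left₀ _ (h.steadyState_pos hb _).ne']

omit hb in
theorem occRate_eq (b : ℝ) (η : Fin (m + 1) → ℝ) :
    occRate (fun e => steadyState b η e * η e) = avgTransmission b η := rfl

theorem occUtility_pos (h : Admissible η) (hm : 1 ≤ m) {g : ℝ → ℝ} (hg : IsUtilityCurve g) :
    0 < occUtility g (steadyState b η) fun e => steadyState b η e * η e := by
  have : Nonempty (Fin m) := ⟨⟨0, hm⟩⟩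
  refine Finset.sum_pos (fun i _ => ?_) Finset.univ_nonempty
  rw [persp, mul_div_cancel_left₀ _ (h.steadyState_pos hb _).ne']
  exact mul_pos (h.steadyState_pos hb _) (hg.pos ⟨h.succ_pos i, (h.mem_Icc _).2⟩)

end Admissible

theorem exists_admissible {m : ℕ} (hm : 1 ≤ m) : ∃ η : Fin (m + 1) → ℝ, Admissible η := by
  refine ⟨fun e => if e = 0 then 0 else 1 / 2, if_pos rfl, ?_, fun e h0 _ => ?_⟩
  · have : Fin.last m ≠ 0 := by
      rw [Ne, Fin.ext_iff, Fin.val_last, Fin.val_zero]; omega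
    simp only [this, if_false]
    norm_num
  · simp only [h0, if_false]
    norm_num

/-- An optimal occupation measure is the one of an admissible policy. -/
theorem IsPricedMax.exists_admissible {m : ℕ} (hm : 1 ≤ m) {g : ℝ → ℝ} (hg : IsUtilityCurve g)
    {b c : ℝ} (hb : b ∈ Ioo (0 : ℝ) 1) {p z : Fin (m + 1) → ℝ} (h : IsPricedMax g b c p z) :
    ∃ η : Fin (m + 1) → ℝ, Admissible η ∧ steadyState b η = p ∧ z = fun e => p e * η e := by
  -- Any admissible policy serves as the regime that transmits at every positive level.
  obtain ⟨η₀, hη₀⟩ := EHNetwork.exists_admissible hm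
  have hz := h.fst_eq_zero_of_snd_eq_zero hg (hη₀.isOccupation hb) (hη₀.sum_steadyState hb)
    fun i => mul_pos (hη₀.steadyState_pos hb _) (hη₀.succ_pos i)
  have hp := h.fst_pos hg hb hz
  have hlt := fun i => h.snd_lt_fst hg hb hz i (hp _)
  have hpos : ∀ i : Fin m, 0 < z i.succ := fun i =>
    (h.occ.nonneg _).lt_of_ne' fun h0 => (hp i.succ).ne' (hz i h0)
  have hpos' : ∀ e, e ≠ 0 → 0 < z e := fun e he => by
    obtain ⟨i, rfl⟩ := Fin.exists_succ_eq.2 he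
    exact hpos i
  have hlast : Fin.last m ≠ 0 := by
    rw [Ne, Fin.ext_iff, Fin.val_last, Fin.val_zero]; omega
  have hmul : ∀ e, p e * (z e / p e) = z e := fun e => mul_div_cancel₀ _ (hp e).ne'
  have hadm : Admissible fun e => z e / p e := by
    refine ⟨by simp [h.occ.zero], ⟨div_pos (hpos' _ hlast) (hp _), ?_⟩, fun e h0 hl => ?_⟩
    · exact (div_le_one (hp _)).2 (h.occ.le _)
    · obtain ⟨i, rfl⟩ := Fin.exists_castSucc_eq.2 hl
      exact ⟨div_pos (hpos' _ h0) (hp _), (div_lt_one (hp _)).2 (hlt i)⟩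
  refine ⟨_, hadm, hadm.steadyState_eq hb ?_, funext fun e => (hmul e).symm⟩
  refine (isSteadyState_iff hadm.1).2 ⟨⟨h.occ.nonneg_fst, h.sum_eq_one⟩, fun i => ?_⟩
  have h1 := h.occ.flow i
  rw [← hmul i.castSucc, ← hmul i.succ] at h1
  rw [cutFlow]
  linear_combination h1

/-! ### The bound from silence, and uniqueness by monotonicity of the price. -/

/-- The optimal payoff is nonnegative, because a sensor may stay silent with a full battery. -/
theorem IsPricedMax.nonneg {m : ℕ} {g : ℝ → ℝ} (hg : IsUtilityCurve g) {b c : ℝ}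
    {p z : Fin (m + 1) → ℝ} (h : IsPricedMax g b c p z) :
    0 ≤ occUtility g p z - c * occRate z := by
  -- A point mass at capacity with no transmissions comes from no admissible policy when `m ≥ 1`,
  -- but it does lie in the polytope.
  have ho : IsOccupation b (fun e => if e = Fin.last m then (1 : ℝ) else 0) fun _ => 0 := by
    refine ⟨rfl, fun _ => le_rfl, fun e => ?_, fun i => ?_⟩
    · split_ifs
      exacts [zero_le_one, le_rfl]
    · simp [(Fin.castSucc_lt_last i).ne]
  have := h.max _ _ ho (by simp)
  simpa [occUtility, occRate, hg.persp_zero_right] using this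

/-- If a policy is a best response to itself against `η`, then `η` does not strictly prefer itself to
that policy: two equilibria, one of them strict, cannot be distinct. -/
theorem not_payoff_lt_of_payoff_le {Ω : Type*} [MeasurableSpace Ω] {μ : Measure Ω}
    {M : PacketModel μ} {m U : ℕ} (hU : 1 ≤ U) {b : ℝ} {η η' : Fin (m + 1) → ℝ}
    (hG : 0 ≤ avgUtility M b η) (hG' : 0 ≤ avgUtility M b η')
    (hP : avgTransmission b η < 1) (hP' : avgTransmission b η' < 1)
    (h' : payoff M U b η' η ≤ payoff M U b η' η') :
    ¬ payoff M U b η η' < payoff M U b η η := by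
  intro h
  have hmono : ∀ {G G' P P' : ℝ}, 0 ≤ G → G ≤ G' → P ≤ P' → P' < 1 →
      ((U : ℝ) - 1) * G / (1 - P) ≤ ((U : ℝ) - 1) * G' / (1 - P') := by
    intro G G' P P' h0 hGG hPP h1
    have hU' : (0 : ℝ) ≤ (U : ℝ) - 1 := sub_nonneg.2 (by exact_mod_cast hU)
    exact div_le_div₀ (mul_nonneg hU' (h0.trans hGG)) (mul_le_mul_of_nonneg_left hGG hU')
      (sub_pos.2 h1) (by linarith)
  have hnn : ∀ {G P : ℝ}, 0 ≤ G → P < 1 → 0 ≤ ((U : ℝ) - 1) * G / (1 - P) := by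
    intro G P h0 h1
    exact div_nonneg (mul_nonneg (sub_nonneg.2 (by exact_mod_cast hU)) h0) (sub_nonneg.2 h1.le)
  have hl := hnn hG hP
  have hl' := hnn hG' hP'
  unfold payoff at h h'
  have hlam : multiplier M U b η = ((U : ℝ) - 1) * avgUtility M b η / (1 - avgTransmission b η) :=
    rfl
  have hlam' : multiplier M U b η' =
    ((U : ℝ) - 1) * avgUtility M b η' / (1 - avgTransmission b η') := rfl
  rw [← hlam] at hl
  rw [← hlam'] at hl'
  -- In either order, the policy with the larger rate also has the larger utility, by its own
  -- optimality, and hence the larger multiplier. The two optimality inequalities then bound the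
  -- utility difference in incompatible ways.
  rcases le_total (avgTransmission b η) (avgTransmission b η') with hPP | hPP
  · have h1 : avgUtility M b η ≤ avgUtility M b η' := by
      nlinarith [mul_nonneg hl' (sub_nonneg.2 hPP)]
    have h2 := hmono hG h1 hPP hP'
    rw [← hlam, ← hlam'] at h2
    nlinarith [mul_nonneg (sub_nonneg.2 h2) (sub_nonneg.2 hPP)]
  · have h1 : avgUtility M b η' ≤ avgUtility M b η := by
      nlinarith [mul_nonneg hl (sub_nonneg.2 hPP)]
    have h2 := hmono hG' h1 hPP hP
    rw [← hlam, ← hlam'] at h2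
    nlinarith [mul_nonneg (sub_nonneg.2 h2) (sub_nonneg.2 hPP)]

end EHNetwork

end

/-- In a network of `U` energy harvesting sensors with battery capacity `emax`, for every scenario
`s` with energy arrival probability `β s`, the symmetric Nash equilibrium exists, is unique, and is
the strict maximizer of its payoff; its average transmission probability is at most
`min (β s) (1 / U)`. -/
theorem theorem2 {Ω : Type*} [MeasurableSpace Ω] (μ : Measure Ω) [IsProbabilityMeasure μ]
    (M : EHNetwork.PacketModel μ)
    (Vbar : ℝ → ℝ) (hVbar : M.IsExpectedUtility Vbar)
    (hreg : EHNetwork.PacketModel.RegularUtility Vbar)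
    (U emax : ℕ) (hU : 1 ≤ U) (hemax : 1 ≤ emax)
    {S : Type*} (β : S → ℝ) (s : S) (hβ : β s ∈ Ioo (0 : ℝ) 1) :
    ∃ ηstar : Fin (emax + 1) → ℝ,
      EHNetwork.IsSNE M U (β s) ηstar ∧
      (∀ η, EHNetwork.IsSNE M U (β s) η → η = ηstar) ∧
      (∀ η, EHNetwork.Admissible η → η ≠ ηstar →
        EHNetwork.payoff M U (β s) ηstar η < EHNetwork.payoff M U (β s) ηstar ηstar) ∧
      EHNetwork.avgTransmission (β s) ηstar ≤ min (β s) (1 / (U : ℝ)) := by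
  have hg := hVbar.isUtilityCurve hreg
  obtain ⟨η₀, hη₀⟩ := EHNetwork.exists_admissible hemax
  -- The exponent `U - 1` makes the price coincide with the multiplier of the game.
  obtain ⟨p, z, hpos, hmax⟩ := EHNetwork.exists_isPricedMax hg hβ (U - 1)
    (hη₀.isOccupation hβ) (hη₀.sum_steadyState hβ) (hη₀.occUtility_pos hβ hemax hg)
  obtain ⟨η, hη, rfl, rfl⟩ := hmax.exists_admissible hemax hg hβ
  rw [Nat.cast_sub hU, Nat.cast_one] at hmax
  rw [hη.occUtility_eq hβ] at hpos hmax
  rw [EHNetwork.Admissible.occRate_eq] at hmax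
  have hPle : ∀ ζ : Fin (emax + 1) → ℝ, EHNetwork.Admissible ζ →
      EHNetwork.avgTransmission (β s) ζ ≤ β s := fun ζ hζ =>
    (hζ.isOccupation hβ).occRate_le hβ.1.le (hζ.sum_steadyState hβ)
  have hstrict : ∀ ζ, EHNetwork.Admissible ζ → ζ ≠ η →
      EHNetwork.payoff M U (β s) η ζ < EHNetwork.payoff M U (β s) η η := by
    intro ζ hζ hne
    obtain ⟨i, hi⟩ : ∃ i : Fin emax, ζ i.succ ≠ η i.succ := by
      by_contra! hall
      refine hne (funext fun e => ?_)
      induction e using Fin.cases with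
      | zero => rw [hζ.1, hη.1]
      | succ i => exact hall i
    have h := hmax.lt_of_ne hg (hη.steadyState_pos hβ) (hζ.isOccupation hβ)
      (hζ.sum_steadyState hβ) (hζ.steadyState_pos hβ) i (by
        rw [mul_div_cancel_left₀ _ (hη.steadyState_pos hβ _).ne',
          mul_div_cancel_left₀ _ (hζ.steadyState_pos hβ _).ne']
        exact hi.symm)
    rwa [hζ.occUtility_eq hβ, hη.occUtility_eq hβ] at h
  refine ⟨η, ⟨hη, fun ζ hζ => ?_⟩, fun ζ hζ => ?_, hstrict, le_min (hPle η hη) ?_⟩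
  · rcases eq_or_ne ζ η with rfl | hne
    · exact le_rfl
    · exact (hstrict ζ hζ hne).le
  · by_contra hne
    refine EHNetwork.not_payoff_lt_of_payoff_le hU hpos.le ?_ ((hPle η hη).trans_lt hβ.2)
      ((hPle ζ hζ.1).trans_lt hβ.2) (hζ.2 η hη) (hstrict ζ hζ.1 hne)
    rw [← hζ.1.occUtility_eq hβ]
    exact (hζ.1.occUtility_pos hβ hemax hg).le
  -- The inequality `G ≥ Λ P` reads `(U - 1) G P ≤ G (1 - P)`; cancelling `G > 0` gives `U P ≤ 1`.
  · have h := hmax.nonneg hg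
    rw [hη.occUtility_eq hβ, EHNetwork.Admissible.occRate_eq] at h
    have hP1 : 0 < 1 - EHNetwork.avgTransmission (β s) η :=
      sub_pos.2 ((hPle η hη).trans_lt hβ.2)
    have hU0 : (0 : ℝ) < U := by exact_mod_cast hU
    rw [le_div_iff₀ hU0]
    rw [div_mul_eq_mul_div, sub_nonneg, div_le_iff₀ hP1] at h
    have h2 : ((U : ℝ) - 1) * EHNetwork.avgTransmission (β s) η
        ≤ 1 - EHNetwork.avgTransmission (β s) η :=
      le_of_mul_le_mul_left (by linarith) hpos
    linarith
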